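/- Let $n\ge 0$ and let $\mathcal Q_n$ be the real $n$-dimensional filiform Lie algebra with basis $e_1,\dots,e_n$, $[e_1,e_k]=-[e_k,e_1]=e_{k+1}$ for $2\le k\le n-1$, all other brackets of basis elements being zero. Let $x_1,\dots,x_n$ be the corresponding linear coordinates on $\mathcal Q_n^*\cong\mathbb R^n$, let $\{f,g\}=\sum_{i,j}\frac{\partial f}{\partial x_i}\frac{\partial g}{\partial x_j}\{x_i,x_j\}$ with $\{x_i,x_j\}=\sum_k c_{ij}^k x_k$, $[e_i,e_j]=\sum_k c^k_{ij}e_k$, be the Lie–Poisson bracket, and put $A(x)=(\{x_i,x_j\}(x))_{i,j}$; the rank of $A(x)$ is the dimension of the coadjoint orbit through $x$. A Casimir function is a smooth function $F$ with $\{x_i,F\}=0$ for all $i$; a Casimir polynomial is a Casimir function that is a polynomial in $x_1,\dots,x_n$. A left-invariant Hamiltonian on $T^*Q_n$ is determined by its restriction $H$ to $T_e^*Q_n=\mathcal Q_n^*$, which can be any function; its Euler equations are $\dot x_i=\{x_i,H\}$, $i=1,\dots,n$. A complete involutive family for $H$ is a family of $m=n-\frac12\max_x\operatorname{rank}A(x)$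 smooth ($C^\infty$) first integrals of the Euler equations that are pairwise in involution; the Euler equations are integrable if there is a complete involutive family that is functionally independent (its differentials are linearly independent) almost everywhere, in the sense stated below. If $n\ge 3$, then the coadjoint orbits of almost all points are two-dimensional: $\operatorname{rank}A(x)=2$ for almost every $x$. For every $n$ and every $H:\mathcal Q_n^*\to\mathbb R$ that is not a Casimir polynomial, the Euler equations of $H$ are integrable, in the following sense. 1. If $H$ is $C^\infty$, there is a complete involutive family for $H$ that is functionally independent on an open dense subset of $\mathcal Q_n^*$. 2. If $H$ is real-analytic, there is a complete involutive family for $H$ that is functionally independent at Lebesgue-almost every point of $\mathcal Q_n^*$. 3. If $H$ is real-analytic and is not a Casimir function, then the family in 2 can be chosen to consist of $H$ itself and $n-2$ Casimir polynomials (here necessarily $n\ge3$). -/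

import Mathlib

open MeasureTheory
open scoped ContDiff

/-! ### The filiform Lie algebras `𝒬ₙ` -/

/-- The underlying space of the filiform Lie algebra `𝒬ₙ`: real vectors `(v₁, …, vₙ)`, where the
index `i : Fin n` stands for the basis element `e_{i+1}`. -/
def Filiform (n : ℕ) : Type := Fin n → ℝ

namespace Filiform

variable {n : ℕ}

instance : AddCommGroup (Filiform n) := inferInstanceAs (AddCommGroup (Fin n → ℝ))

noncomputable instance : Module ℝ (Filiform n) := inferInstanceAs (Module ℝ (Fin n → ℝ))

/-- `[e₁, e_k] = -[e_k, e₁] = e_{k+1}` for `2 ≤ k ≤ n - 1`, all other brackets of basis elements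
being zero, extended bilinearly. -/
instance : Bracket (Filiform n) (Filiform n) where
  bracket v w := fun k =>
    if 2 ≤ k.val then
      v ⟨0, by have := k.isLt; omega⟩ * w ⟨k.val - 1, by have := k.isLt; omega⟩
        - w ⟨0, by have := k.isLt; omega⟩ * v ⟨k.val - 1, by have := k.isLt; omega⟩
    else 0

theorem bracket_apply (v w : Filiform n) (k : Fin n) :
    (⁅v, w⁆ : Filiform n) k = if 2 ≤ k.val then
      v ⟨0, by have := k.isLt; omega⟩ * w ⟨k.val - 1, by have := k.isLt; omega⟩
        - w ⟨0, by have := k.isLt; omega⟩ * v ⟨k.val - 1, by have := k.isLt; omega⟩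
    else 0 := rfl

theorem add_apply' (v w : Filiform n) (k : Fin n) : (v + w) k = v k + w k := rfl

theorem smul_apply' (c : ℝ) (v : Filiform n) (k : Fin n) : (c • v) k = c * v k := rfl

theorem zero_apply' (k : Fin n) : (0 : Filiform n) k = 0 := rfl

noncomputable instance : LieRing (Filiform n) where
  add_lie u v w := by
    funext k
    simp only [bracket_apply, add_apply']
    split_ifs <;> ring
  lie_add u v w := by
    funext k
    simp only [bracket_apply, add_apply']
    split_ifs <;> ring
  lie_self v := by
    funext k
    simp only [bracket_apply, zero_apply']
    split_ifs <;> ring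
  leibniz_lie u v w := by
    funext k
    simp only [bracket_apply, add_apply']
    split_ifs <;> first | omega | ring

noncomputable instance : LieAlgebra ℝ (Filiform n) where
  lie_smul c v w := by
    funext k
    simp only [bracket_apply, smul_apply']
    split_ifs <;> ring

/-- The standard basis `e₁, …, eₙ` of `𝒬ₙ`. -/
noncomputable def stdBasis (n : ℕ) : Module.Basis (Fin n) ℝ (Filiform n) :=
  Pi.basisFun ℝ (Fin n)

theorem stdBasis_apply (i k : Fin n) : stdBasis n i k = if k = i then 1 else 0 := by
  have h : (stdBasis n i : Fin n → ℝ) = Pi.single i 1 := Pi.basisFun_apply ℝ (Fin n) i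
  exact (congrFun h k).trans (Pi.single_apply i 1 k)

/-- The relation `[e₁, e_k] = e_{k+1}`, `2 ≤ k ≤ n - 1` (indices shifted by one). -/
theorem lie_stdBasis (k : ℕ) (hk : 1 ≤ k) (hn : k + 1 < n) :
    ⁅stdBasis n ⟨0, by omega⟩, stdBasis n ⟨k, by omega⟩⁆ = stdBasis n ⟨k + 1, hn⟩ := by
  funext j
  simp only [bracket_apply, stdBasis_apply, Fin.ext_iff]
  split_ifs <;> first | omega | norm_num

/-- The remaining brackets of basis elements are zero: `[e₁, eₙ] = 0`. -/
theorem lie_stdBasis_last (k : ℕ) (hn : k + 1 = n) :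
    ⁅stdBasis n ⟨0, by omega⟩, stdBasis n ⟨k, by omega⟩⁆ = 0 := by
  funext j
  have := j.isLt
  simp only [bracket_apply, stdBasis_apply, Fin.ext_iff, zero_apply']
  split_ifs <;> first | omega | norm_num

/-- The remaining brackets of basis elements are zero: `[e_i, e_j] = 0` for `i, j ≥ 2`. -/
theorem lie_stdBasis_of_pos (i j : Fin n) (hi : 1 ≤ i.val) (hj : 1 ≤ j.val) :
    ⁅stdBasis n i, stdBasis n j⁆ = 0 := by
  funext k
  simp only [bracket_apply, stdBasis_apply, Fin.ext_iff, zero_apply']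
  split_ifs <;> first | omega | norm_num

end Filiform

/-! ### Lie–Poisson brackets and Euler equations

`𝔤` is a real Lie algebra with a finite basis `b`; the coalgebra `𝔤*` is identified with `ι → ℝ`
through the coordinate functions `x i = ξ (b i)`, `ξ ∈ 𝔤*`. -/

section LiePoisson

variable {ι : Type*} [Fintype ι] [DecidableEq ι]
  {𝔤 : Type*} [LieRing 𝔤] [LieAlgebra ℝ 𝔤]

/-- The matrix `A x = ({xᵢ, xⱼ}) = (∑ₖ cᵏᵢⱼ xₖ)`, with structure constants
`[eᵢ, eⱼ] = ∑ₖ cᵏᵢⱼ eₖ`. Its range at `x` is the tangent space at `x` of the coadjoint orbit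
through `x`, so its rank at `x` is the dimension of that orbit. -/
noncomputable def poissonMatrix (b : Module.Basis ι ℝ 𝔤) (x : ι → ℝ) : Matrix ι ι ℝ :=
  Matrix.of fun i j => ∑ k, b.repr ⁅b i, b j⁆ k * x k

/-- The Lie–Poisson bracket `{f, g} = ∑ᵢⱼ ∂f/∂xᵢ ∂g/∂xⱼ {xᵢ, xⱼ}`. -/
noncomputable def liePoisson (b : Module.Basis ι ℝ 𝔤) (f g : (ι → ℝ) → ℝ) (x : ι → ℝ) : ℝ :=
  ∑ i, ∑ j, fderiv ℝ f x (Pi.single i 1) * fderiv ℝ g x (Pi.single j 1) * poissonMatrix b x i j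

/-- The vector field of the Euler equations `dxᵢ/dt = {xᵢ, H}`. -/
noncomputable def eulerField (b : Module.Basis ι ℝ 𝔤) (H : (ι → ℝ) → ℝ) (x : ι → ℝ) : ι → ℝ :=
  fun i => liePoisson b (fun y => y i) H x

/-- `F` is a Casimir function: a smooth function with `{xᵢ, F} = 0` for all `i`. -/
def IsCasimir (b : Module.Basis ι ℝ 𝔤) (F : (ι → ℝ) → ℝ) : Prop :=
  ContDiff ℝ ∞ F ∧ ∀ i x, liePoisson b (fun y => y i) F x = 0

/-- `F` is a Casimir polynomial: a Casimir function that is a polynomial in the coordinates. -/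
def IsCasimirPolynomial (b : Module.Basis ι ℝ 𝔤) (F : (ι → ℝ) → ℝ) : Prop :=
  (∃ p : MvPolynomial ι ℝ, ∀ x, F x = MvPolynomial.eval x p) ∧ IsCasimir b F

/-- The rank of the Poisson matrix at a generic point, i.e. its maximal rank: the dimension of the
generic coadjoint orbits. -/
noncomputable def genericRank (b : Module.Basis ι ℝ 𝔤) : ℕ :=
  ⨆ x : ι → ℝ, (poissonMatrix b x).rank

/-- `F 0, …, F (m - 1)` are smooth first integrals of the Euler equations of `H`, they are pairwise
in involution, and their number is `m = dim 𝔤 - (dim of a generic coadjoint orbit) / 2`, the number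
required for complete (Liouville) integrability on `𝔤*`. -/
structure IsCompleteInvolutive (b : Module.Basis ι ℝ 𝔤) (H : (ι → ℝ) → ℝ) {m : ℕ}
    (F : Fin m → (ι → ℝ) → ℝ) : Prop where
  smooth : ∀ a, ContDiff ℝ ∞ (F a)
  firstIntegral : ∀ a x, fderiv ℝ (F a) x (eulerField b H x) = 0
  involution : ∀ a c x, liePoisson b (F a) (F c) x = 0
  number : 2 * m + genericRank b = 2 * Fintype.card ι

/-- The functions `F a` are functionally independent almost everywhere (for Lebesgue measure). -/
def FunctionallyIndependentAE {m : ℕ} (F : Fin m → (ι → ℝ) → ℝ) : Prop :=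
  ∀ᵐ x : ι → ℝ, LinearIndependent ℝ fun a => fderiv ℝ (F a) x

/-- The functions `F a` are functionally independent on an open dense set. -/
def FunctionallyIndependentOnDense {m : ℕ} (F : Fin m → (ι → ℝ) → ℝ) : Prop :=
  ∃ U : Set (ι → ℝ), IsOpen U ∧ Dense U ∧
    ∀ x ∈ U, LinearIndependent ℝ fun a => fderiv ℝ (F a) x

end LiePoisson

/-! ### Zero sets of real-analytic functions -/

/-! Every nonzero bracket of basis elements involves `e₁`, so the Poisson bivector is the wedge of
two vectors, `firstVec` and `shift x` (`poissonMatrix_eq`). A function whose differential kills both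
is a Casimir, and the rank is at most 2. For n ≥ 3 it equals 2 where the last coordinate is nonzero,
and there the n - 2 polynomials `casimir` are independent (`linearIndependent_fderiv_casimir`). One
more first integral F then suffices, provided its differential is nonzero on one of the two vectors
(`linearIndependent_fderiv_cons`). If H is analytic and not Casimir, F = H works: the relevant
derivatives are analytic, and one is not identically zero, hence nonzero almost everywhere. If H is
Casimir, its Euler field is zero and F = x₁ works. If H is only smooth, a function supported in the
interior of its critical set is added (`exists_firstIntegral_dense_regularSet`). For n ≤ 2 the
bracket vanishes and the coordinates form the family. -/

theorem ae_ne_zero_of_analyticOnNhd_real {f : ℝ → ℝ} (hf : AnalyticOnNhd ℝ f Set.univ)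
    {a : ℝ} (ha : f a ≠ 0) : ∀ᵐ t : ℝ, f t ≠ 0 := by
  have h := hf.preimage_zero_mem_codiscrete ha
  have h2 := ae_restrict_le_codiscreteWithin (μ := (volume : Measure ℝ)) MeasurableSet.univ h
  rw [Measure.restrict_univ] at h2
  filter_upwards [h2] with t ht
  simpa using ht

/-- Induction on the dimension with Fubini: f is nonzero at almost every y of the slice with first
coordinate a 0, and for each such y the line in the first coordinate carries a nonzero analytic
function of one variable. -/
theorem ae_ne_zero_of_analyticOnNhd_pi : ∀ {n : ℕ} {f : (Fin n → ℝ) → ℝ},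
    AnalyticOnNhd ℝ f Set.univ → ∀ {a : Fin n → ℝ}, f a ≠ 0 → ∀ᵐ x : Fin n → ℝ, f x ≠ 0
  | 0, f, _, a, ha => Filter.Eventually.of_forall fun x => by rwa [Subsingleton.elim x a]
  | n + 1, f, hf, a, ha => by
    have hfω : ContDiff ℝ ω f := contDiff_omega_iff_analyticOnNhd.2 hf
    have hcons : ContDiff ℝ ω (fun p : ℝ × (Fin n → ℝ) =>
        (Fin.cons p.1 p.2 : Fin (n + 1) → ℝ)) := by
      refine contDiff_pi.2 fun i => ?_
      refine Fin.cases ?_ (fun j => ?_) i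
      · simpa using contDiff_fst
      · simpa [Function.comp_def] using
          (contDiff_apply ℝ ℝ j).comp (contDiff_snd (E := ℝ) (F := Fin n → ℝ))
    have hg : ContDiff ℝ ω (fun p : ℝ × (Fin n → ℝ) =>
        f (Fin.cons p.1 p.2 : Fin (n + 1) → ℝ)) := hfω.comp hcons
    have hslice : ∀ᵐ y : Fin n → ℝ, f (Fin.cons (a 0) y : Fin (n + 1) → ℝ) ≠ 0 := by
      refine ae_ne_zero_of_analyticOnNhd_pi (a := Fin.tail a)
        (contDiff_omega_iff_analyticOnNhd.1
          (hg.comp (contDiff_const.prodMk contDiff_id))) ?_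
      simpa using ha
    have hmeas : MeasurableSet {p : ℝ × (Fin n → ℝ) |
        ¬ f (Fin.cons p.1 p.2 : Fin (n + 1) → ℝ) ≠ 0} := by
      simpa only [not_not] using (isClosed_eq hg.continuous continuous_const).measurableSet
    have hprod : ∀ᵐ p : ℝ × (Fin n → ℝ), f (Fin.cons p.1 p.2 : Fin (n + 1) → ℝ) ≠ 0 := by
      rw [ae_iff, Measure.volume_eq_prod, Measure.prod_apply_symm hmeas,
        lintegral_eq_zero_iff (measurable_measure_prodMk_right hmeas)]
      filter_upwards [hslice] with y hy
      exact ae_ne_zero_of_analyticOnNhd_real (f := fun t => f (Fin.cons t y : Fin (n + 1) → ℝ))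
        (contDiff_omega_iff_analyticOnNhd.1
          (hg.comp (contDiff_id.prodMk contDiff_const))) hy
    have hpres := (volume_preserving_piFinSuccAbove (fun _ : Fin (n + 1) => ℝ) 0)
    have := hpres.quasiMeasurePreserving.ae hprod
    filter_upwards [this] with x hx
    convert hx using 2
    funext i
    refine Fin.cases ?_ (fun j => ?_) i <;>
      simp [MeasurableEquiv.piFinSuccAbove, Fin.insertNthEquiv, Fin.tail]

/-! ### Linear independence of functionals from a triangular pairing -/

/-- Evaluating a relation at `w b` kills the terms a > b by triangularity and the terms a < b by
induction. -/
theorem linearIndependent_of_triangular {m : ℕ} {E : Type*} [NormedAddCommGroup E]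
    [NormedSpace ℝ E] {φ : Fin m → E →L[ℝ] ℝ} (w : Fin m → E)
    (hlt : ∀ a b, b < a → φ a (w b) = 0) (hdiag : ∀ a, φ a (w a) ≠ 0) :
    LinearIndependent ℝ φ := by
  rw [Fintype.linearIndependent_iff]
  intro g hg b
  induction b using WellFoundedLT.induction with
  | _ b ih =>
    have h := congrArg (fun ψ : E →L[ℝ] ℝ => ψ (w b)) hg
    simp only [_root_.sum_apply, _root_.smul_apply, smul_eq_mul,
      _root_.zero_apply] at h
    rw [Finset.sum_eq_single b] at h
    · exact (mul_eq_zero.1 h).resolve_right (hdiag b)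
    · intro a _ hab
      rcases lt_or_gt_of_ne hab with h1 | h1
      · rw [ih a h1, zero_mul]
      · rw [hlt a b h1, mul_zero]
    · simp

/-! ### Derivatives of polynomial functions -/

theorem differentiableAt_eval {ι : Type*} [Fintype ι] (p : MvPolynomial ι ℝ) (x : ι → ℝ) :
    DifferentiableAt ℝ (fun y => MvPolynomial.eval y p) x :=
  ((AnalyticOnNhd.eval_mvPolynomial (𝕜 := ℝ) p) x (Set.mem_univ x)).differentiableAt

/-- As functions of p, both sides are linear and obey the Leibniz rule over evaluation at x, so
agreement on the variables suffices. -/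
theorem fderiv_eval_mkDerivation {ι : Type*} [Fintype ι] (w : ι → MvPolynomial ι ℝ)
    (p : MvPolynomial ι ℝ) (x : ι → ℝ) :
    fderiv ℝ (fun y => MvPolynomial.eval y p) x (fun i => MvPolynomial.eval x (w i)) =
      MvPolynomial.eval x (MvPolynomial.mkDerivation ℝ w p) := by
  induction p using MvPolynomial.induction_on with
  | C a => simp
  | add p q hp hq =>
    simp only [map_add]
    rw [fderiv_fun_add (differentiableAt_eval p x) (differentiableAt_eval q x)]
    simp [hp, hq]
  | mul_X p i hp =>
    simp only [map_mul, MvPolynomial.eval_X, Derivation.leibniz, MvPolynomial.mkDerivation_X,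
      map_add, smul_eq_mul]
    rw [fderiv_fun_mul (differentiableAt_eval p x) (by fun_prop)]
    have : fderiv ℝ (fun y : ι → ℝ => y i) x = ContinuousLinearMap.proj i :=
      (ContinuousLinearMap.proj (R := ℝ) (φ := fun _ : ι => ℝ) i).fderiv
    simp [hp, this]

theorem fderiv_eval_single {ι : Type*} [Fintype ι] [DecidableEq ι]
    (p : MvPolynomial ι ℝ) (x : ι → ℝ) (i : ι) :
    fderiv ℝ (fun y => MvPolynomial.eval y p) x (Pi.single i 1) =
      MvPolynomial.eval x (MvPolynomial.pderiv i p) := by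
  rw [MvPolynomial.pderiv_def, ← fderiv_eval_mkDerivation]
  congr 1
  funext j
  by_cases h : j = i
  · subst h; simp
  · simp [h]

/-! ### The Lie–Poisson bracket of `𝒬ₙ` -/

namespace Filiform

/-- The coordinate `x k`, extended by zero to all `k : ℕ`. -/
def coord {n : ℕ} (x : Fin n → ℝ) (k : ℕ) : ℝ := if h : k < n then x ⟨k, h⟩ else 0

/-- The point `dx₁` of the coalgebra, or zero if `n = 0`. -/
def firstVec (n : ℕ) : Fin n → ℝ := fun i => if i.val = 0 then 1 else 0

/-- The vector `v` with `{x₁, f} = f'(v)` at `x`. -/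
def shift {n : ℕ} (x : Fin n → ℝ) : Fin n → ℝ :=
  fun i => if 1 ≤ i.val then coord x (i.val + 1) else 0

theorem poissonMatrix_eq {n : ℕ} (x : Fin n → ℝ) :
    poissonMatrix (stdBasis n) x =
      Matrix.vecMulVec (firstVec n) (shift x) - Matrix.vecMulVec (shift x) (firstVec n) := by
  -- The sum is the pairing of x with [e₁, e_j] for j ≥ 2; it is empty for j = 1 because 2 ≤ k
  -- forces k - 1 ≥ 1.
  have key : ∀ j : Fin n, ∑ k : Fin n,
      (if h : 2 ≤ k.val then stdBasis n j ⟨k.val - 1, by have := k.isLt; omega⟩ else 0) * x k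
        = shift x j := by
    intro j
    by_cases hj : 1 ≤ j.val ∧ j.val + 1 < n
    · rw [Finset.sum_eq_single ⟨j.val + 1, hj.2⟩]
      · simp [stdBasis_apply, shift, coord, hj.1, hj.2]
      · intro k _ hk
        have : ¬ (2 ≤ k.val ∧ k.val - 1 = j.val) := fun h => hk (Fin.ext (by simp; omega))
        simp only [stdBasis_apply, Fin.ext_iff]
        split_ifs <;> first | (exfalso; omega) | simp
      · simp
    · have : shift x j = 0 := by
        simp only [shift, coord]
        split_ifs <;> first | rfl | (exfalso; omega)
      rw [this]
      refine Finset.sum_eq_zero fun k _ => ?_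
      have := k.isLt
      simp only [stdBasis_apply, Fin.ext_iff]
      split_ifs <;> first | (exfalso; omega) | simp
  ext i j
  have hrepr : ∀ (v : Filiform n) k, (stdBasis n).repr v k = v k := fun v k =>
    Pi.basisFun_repr (R := ℝ) (η := Fin n) v k
  simp only [poissonMatrix, Matrix.of_apply, hrepr, Matrix.sub_apply, Matrix.vecMulVec_apply]
  rw [← key i, ← key j, Finset.mul_sum, Finset.sum_mul, ← Finset.sum_sub_distrib]
  refine Finset.sum_congr rfl fun k _ => ?_
  have h0 : ∀ (i : Fin n) h, stdBasis n i ⟨0, h⟩ = firstVec n i := fun i h => by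
    simp [stdBasis_apply, firstVec, Fin.ext_iff, eq_comm]
  rw [bracket_apply, h0, h0]
  split_ifs <;> ring

theorem sum_apply_single {n : ℕ} (φ : (Fin n → ℝ) →L[ℝ] ℝ) (v : Fin n → ℝ) :
    ∑ i, φ (Pi.single i 1) * v i = φ v := by
  conv_rhs => rw [← Finset.univ_sum_single v, map_sum]
  refine Finset.sum_congr rfl fun i _ => ?_
  rw [mul_comm, ← smul_eq_mul, ← map_smul, ← Pi.single_smul, smul_eq_mul, mul_one]

theorem liePoisson_eq {n : ℕ} (f g : (Fin n → ℝ) → ℝ) (x : Fin n → ℝ) :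
    liePoisson (stdBasis n) f g x =
      fderiv ℝ f x (firstVec n) * fderiv ℝ g x (shift x)
        - fderiv ℝ f x (shift x) * fderiv ℝ g x (firstVec n) := by
  simp only [liePoisson, poissonMatrix_eq, Matrix.sub_apply, Matrix.vecMulVec_apply]
  rw [← sum_apply_single (fderiv ℝ f x) (firstVec n), ← sum_apply_single (fderiv ℝ f x) (shift x),
    ← sum_apply_single (fderiv ℝ g x) (firstVec n), ← sum_apply_single (fderiv ℝ g x) (shift x),
    Finset.sum_mul_sum, Finset.sum_mul_sum, ← Finset.sum_sub_distrib]
  refine Finset.sum_congr rfl fun i _ => ?_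
  rw [← Finset.sum_sub_distrib]
  exact Finset.sum_congr rfl fun j _ => by ring

theorem fderiv_coordinate {n : ℕ} (i : Fin n) (x : Fin n → ℝ) :
    fderiv ℝ (fun y : Fin n → ℝ => y i) x = ContinuousLinearMap.proj i :=
  (ContinuousLinearMap.proj (R := ℝ) (φ := fun _ : Fin n => ℝ) i).fderiv

theorem eulerField_eq {n : ℕ} (H : (Fin n → ℝ) → ℝ) (x : Fin n → ℝ) :
    eulerField (stdBasis n) H x =
      fderiv ℝ H x (shift x) • firstVec n - fderiv ℝ H x (firstVec n) • shift x := by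
  funext i
  simp only [eulerField, liePoisson_eq, fderiv_coordinate, ContinuousLinearMap.proj_apply,
    Pi.sub_apply, Pi.smul_apply, smul_eq_mul]
  ring

theorem fderiv_eulerField {n : ℕ} (f H : (Fin n → ℝ) → ℝ) (x : Fin n → ℝ) :
    fderiv ℝ f x (eulerField (stdBasis n) H x) = liePoisson (stdBasis n) f H x := by
  rw [eulerField_eq, liePoisson_eq, map_sub, map_smul, map_smul, smul_eq_mul, smul_eq_mul]
  ring

theorem isCasimir_of_fderiv_eq_zero {n : ℕ} {F : (Fin n → ℝ) → ℝ} (hF : ContDiff ℝ ∞ F)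
    (h : ∀ x, fderiv ℝ F x (firstVec n) = 0 ∧ fderiv ℝ F x (shift x) = 0) :
    IsCasimir (stdBasis n) F :=
  ⟨hF, fun i x => by rw [liePoisson_eq, (h x).1, (h x).2]; ring⟩

theorem liePoisson_eq_zero_of_isCasimir {n : ℕ} {F : (Fin n → ℝ) → ℝ}
    (hF : IsCasimir (stdBasis n) F) (f : (Fin n → ℝ) → ℝ) (x : Fin n → ℝ) :
    liePoisson (stdBasis n) f F x = 0 := by
  rw [← fderiv_eulerField]
  have : eulerField (stdBasis n) F x = 0 := funext fun i => hF.2 i x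
  rw [this, map_zero]

/-! ### The rank of the Poisson matrix -/

theorem rank_poissonMatrix_le {n : ℕ} (x : Fin n → ℝ) :
    (poissonMatrix (stdBasis n) x).rank ≤ 2 := by
  have h : poissonMatrix (stdBasis n) x =
      (Matrix.of fun i => ![firstVec n i, -shift x i]) *
        (Matrix.of ![shift x, firstVec n] : Matrix (Fin 2) (Fin n) ℝ) := by
    ext i j
    simp [poissonMatrix_eq, Matrix.mul_apply, Matrix.vecMulVec_apply, sub_eq_add_neg]
  rw [h]
  exact (Matrix.rank_mul_le_left _ _).trans (Matrix.rank_le_width _)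

theorem shift_second_last {N : ℕ} (x : Fin (N + 3) → ℝ) :
    shift x ⟨N + 1, by omega⟩ = x (Fin.last (N + 2)) := by
  simp [shift, coord, Fin.last]

theorem rank_poissonMatrix {N : ℕ} {x : Fin (N + 3) → ℝ} (hx : x (Fin.last (N + 2)) ≠ 0) :
    (poissonMatrix (stdBasis (N + 3)) x).rank = 2 := by
  refine le_antisymm (rank_poissonMatrix_le x) ?_
  -- Since [e₁, e_{n-1}] = e_n, this principal minor has determinant x_n².
  let r : Fin 2 → Fin (N + 3) := ![0, ⟨N + 1, by omega⟩]
  have h2 : ((poissonMatrix (stdBasis (N + 3)) x).submatrix r r).rank = 2 := by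
    rw [Matrix.rank_of_det_ne_zero, Fintype.card_fin]
    rw [Matrix.det_fin_two]
    have h0 : shift x 0 = 0 := by simp [shift]
    simp [poissonMatrix_eq, Matrix.vecMulVec_apply, r, shift_second_last, h0,
      firstVec, hx]
  calc 2 = _ := h2.symm
    _ ≤ _ := Matrix.rank_submatrix_le _ _ _

theorem genericRank_eq_two (N : ℕ) : genericRank (stdBasis (N + 3)) = 2 := by
  refine le_antisymm (ciSup_le fun x => rank_poissonMatrix_le x) ?_
  -- A supremum in ℕ is only meaningful with an upper bound, here 2.
  refine le_ciSup_of_le ⟨2, ?_⟩ (fun _ => 1) (rank_poissonMatrix (by simp)).ge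
  rintro _ ⟨x, rfl⟩
  exact rank_poissonMatrix_le x

theorem shift_eq_zero {n : ℕ} (hn : n ≤ 2) (x : Fin n → ℝ) : shift x = 0 := by
  funext i
  simp only [shift, coord, Pi.zero_apply]
  split_ifs <;> first | rfl | (exfalso; omega)

theorem genericRank_eq_zero {n : ℕ} (hn : n ≤ 2) : genericRank (stdBasis n) = 0 := by
  simp [genericRank, poissonMatrix_eq, shift_eq_zero hn]

/-! ### The Casimir polynomials -/

/-- The coordinate polynomial with index `k`, zero for `k` out of range. -/
noncomputable def coordPoly (n k : ℕ) : MvPolynomial (Fin n) ℝ :=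
  if h : k < n then MvPolynomial.X ⟨k, h⟩ else 0

theorem eval_coordPoly {n : ℕ} (x : Fin n → ℝ) (k : ℕ) :
    MvPolynomial.eval x (coordPoly n k) = coord x k := by
  simp only [coordPoly, coord]
  split_ifs <;> simp

theorem pderiv_coordPoly {n : ℕ} (i : Fin n) (k : ℕ) :
    MvPolynomial.pderiv i (coordPoly n k) = if i.val = k then 1 else 0 := by
  have hi := i.isLt
  by_cases h : k < n
  · simp only [coordPoly, dif_pos h, MvPolynomial.pderiv_X, Pi.single_apply, Fin.ext_iff, eq_comm]
  · rw [coordPoly, dif_neg h, map_zero, if_neg (by omega)]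

/-- The derivation `{x₁, ·}` on polynomials. -/
noncomputable def shiftDerivation (n : ℕ) :
    Derivation ℝ (MvPolynomial (Fin n) ℝ) (MvPolynomial (Fin n) ℝ) :=
  MvPolynomial.mkDerivation ℝ fun i => if 1 ≤ i.val then coordPoly n (i.val + 1) else 0

theorem shiftDerivation_coordPoly {n k : ℕ} (hk : 1 ≤ k) :
    shiftDerivation n (coordPoly n k) = coordPoly n (k + 1) := by
  by_cases h : k < n
  · conv_lhs => rw [coordPoly, dif_pos h]
    rw [shiftDerivation, MvPolynomial.mkDerivation_X, if_pos hk]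
  · simp [coordPoly, h, show ¬ k + 1 < n by omega]

theorem fderiv_eval_shift {n : ℕ} (p : MvPolynomial (Fin n) ℝ) (x : Fin n → ℝ) :
    fderiv ℝ (fun y => MvPolynomial.eval y p) x (shift x) =
      MvPolynomial.eval x (shiftDerivation n p) := by
  rw [shiftDerivation, ← fderiv_eval_mkDerivation]
  congr 1
  funext i
  simp only [shift]
  split_ifs <;> simp [eval_coordPoly]

theorem fderiv_eval_firstVec {N : ℕ} (p : MvPolynomial (Fin (N + 1)) ℝ) (x : Fin (N + 1) → ℝ) :
    fderiv ℝ (fun y => MvPolynomial.eval y p) x (firstVec (N + 1)) =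
      MvPolynomial.eval x (MvPolynomial.pderiv 0 p) := by
  rw [← fderiv_eval_single]
  congr 1
  funext i
  by_cases h : i = 0
  · subst h
    simp [firstVec]
  · rw [firstVec, if_neg (show ¬ i.val = 0 from fun h' => h (Fin.ext h')), Pi.single_eq_of_ne h]

/-- With `s = x_{n-1}`, `t = x_n`, a truncation of `exp (-(s / t) {x₁, ·}) x_k`, made integral by
a power of `t`. -/
noncomputable def invariantPoly (N k L : ℕ) : ℕ → MvPolynomial (Fin (N + 3)) ℝ := fun M =>
  ∑ j ∈ Finset.range (M + 1), ((-1 : ℝ) ^ j / j.factorial) •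
    (coordPoly (N + 3) (N + 1) ^ j * coordPoly (N + 3) (N + 2) ^ (L - j) *
      coordPoly (N + 3) (k + j))

/-- Write D = {x₁, ·}. Since D s = t and D t = 0, differentiating s^j in the term j cancels
differentiating the last factor in the term j - 1. The sum telescopes to the derivative of the last
factor in the top term. -/
theorem shiftDerivation_invariantPoly {N k L : ℕ} (hk : 1 ≤ k) (M : ℕ) (hM : M ≤ L) :
    shiftDerivation (N + 3) (invariantPoly N k L M) = ((-1 : ℝ) ^ M / M.factorial) •
      (coordPoly (N + 3) (N + 1) ^ M * coordPoly (N + 3) (N + 2) ^ (L - M) *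
        coordPoly (N + 3) (k + M + 1)) := by
  have hs : shiftDerivation (N + 3) (coordPoly (N + 3) (N + 1)) = coordPoly (N + 3) (N + 2) :=
    shiftDerivation_coordPoly (by omega)
  have ht : shiftDerivation (N + 3) (coordPoly (N + 3) (N + 2)) = 0 := by
    rw [shiftDerivation_coordPoly (by omega), coordPoly, dif_neg (by omega)]
  induction M with
  | zero =>
    simp [invariantPoly, Derivation.leibniz, Derivation.leibniz_pow, ht,
      shiftDerivation_coordPoly hk]
  | succ M ih =>
    have ih := ih (by omega)
    rw [invariantPoly, Finset.sum_range_succ, ← invariantPoly, map_add, ih]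
    obtain ⟨r, rfl⟩ : ∃ r, L = M + 1 + r := ⟨L - (M + 1), by omega⟩
    rw [show M + 1 + r - M = r + 1 by omega, show M + 1 + r - (M + 1) = r by omega]
    simp only [Derivation.map_smul, Derivation.leibniz, Derivation.leibniz_pow, hs, ht,
      shiftDerivation_coordPoly (show 1 ≤ k + (M + 1) by omega), smul_eq_mul, smul_zero, mul_zero,
      Nat.add_sub_cancel, nsmul_eq_mul]
    -- The coefficient identity behind the cancellation.
    have hc : ((-1 : ℝ) ^ M / M.factorial) =
        -(((-1 : ℝ) ^ (M + 1) / (M + 1).factorial) * ((M + 1 : ℕ) : ℝ)) := by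
      rw [Nat.factorial_succ]
      have := Nat.factorial_ne_zero M
      push_cast
      field_simp
      ring
    rw [hc]
    simp only [MvPolynomial.smul_eq_C_mul, map_neg, map_mul, map_natCast]
    ring_nf

/-- A Casimir polynomial with leading differential `t ^ (N + 3) dx_{a+1}` for `a < N`, and `x_n`
for `a = N`. -/
noncomputable def casimirPoly (N : ℕ) (a : Fin (N + 1)) : MvPolynomial (Fin (N + 3)) ℝ :=
  if a.val < N then invariantPoly N (a.val + 1) (N + 3) (N + 3) else coordPoly (N + 3) (N + 2)

theorem shiftDerivation_casimirPoly (N : ℕ) (a : Fin (N + 1)) :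
    shiftDerivation (N + 3) (casimirPoly N a) = 0 := by
  rw [casimirPoly]
  split_ifs
  -- The truncation order N + 3 pushes the index of the surviving term out of range.
  · have h : coordPoly (N + 3) (a.val + 1 + (N + 3) + 1) = 0 := by
      rw [coordPoly, dif_neg (by omega)]
    rw [shiftDerivation_invariantPoly (by omega) _ le_rfl, h, mul_zero, smul_zero]
  · rw [shiftDerivation_coordPoly (by omega), coordPoly, dif_neg (by omega)]

/-- The variable i is neither s nor t, and the factor of index k + j with j > 0 lies beyond i, so
only the term j = 0, namely t^L x_k, can contribute. -/
theorem pderiv_invariantPoly {N k L M : ℕ} (i : Fin (N + 3)) (hi : i.val ≤ N) (hk : i.val ≤ k) :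
    MvPolynomial.pderiv i (invariantPoly N k L M) =
      if i.val = k then coordPoly (N + 3) (N + 2) ^ L else 0 := by
  have hs : MvPolynomial.pderiv i (coordPoly (N + 3) (N + 1)) = 0 := by
    rw [pderiv_coordPoly, if_neg (by omega)]
  have ht : MvPolynomial.pderiv i (coordPoly (N + 3) (N + 2)) = 0 := by
    rw [pderiv_coordPoly, if_neg (by omega)]
  simp only [invariantPoly, map_sum, Derivation.map_smul, Derivation.leibniz,
    Derivation.leibniz_pow, hs, ht, pderiv_coordPoly, smul_zero, add_zero]
  rw [Finset.sum_range_succ', Finset.sum_eq_zero, zero_add]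
  · simp
  · intro j _
    rw [if_neg (by omega), smul_zero, smul_zero]

/-- The Casimir functions defined by `casimirPoly`. -/
noncomputable def casimir (N : ℕ) (a : Fin (N + 1)) (x : Fin (N + 3) → ℝ) : ℝ :=
  MvPolynomial.eval x (casimirPoly N a)

theorem contDiff_casimir (N : ℕ) (a : Fin (N + 1)) : ContDiff ℝ ∞ (casimir N a) :=
  (contDiff_omega_iff_analyticOnNhd.2
    (AnalyticOnNhd.eval_mvPolynomial (𝕜 := ℝ) (casimirPoly N a))).of_le le_top

theorem fderiv_casimir_shift (N : ℕ) (a : Fin (N + 1)) (x : Fin (N + 3) → ℝ) :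
    fderiv ℝ (casimir N a) x (shift x) = 0 := by
  rw [show casimir N a = fun y => MvPolynomial.eval y (casimirPoly N a) from rfl,
    fderiv_eval_shift, shiftDerivation_casimirPoly, map_zero]

theorem fderiv_casimir_firstVec (N : ℕ) (a : Fin (N + 1)) (x : Fin (N + 3) → ℝ) :
    fderiv ℝ (casimir N a) x (firstVec (N + 3)) = 0 := by
  rw [show casimir N a = fun y => MvPolynomial.eval y (casimirPoly N a) from rfl,
    fderiv_eval_firstVec, casimirPoly]
  split_ifs
  · rw [pderiv_invariantPoly _ (by simp) (by simp), if_neg (by simp), map_zero]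
  · rw [pderiv_coordPoly, if_neg (by simp), map_zero]

theorem isCasimir_casimir (N : ℕ) (a : Fin (N + 1)) :
    IsCasimir (stdBasis (N + 3)) (casimir N a) :=
  isCasimir_of_fderiv_eq_zero (contDiff_casimir N a) fun x =>
    ⟨fderiv_casimir_firstVec N a x, fderiv_casimir_shift N a x⟩

theorem isCasimirPolynomial_casimir (N : ℕ) (a : Fin (N + 1)) :
    IsCasimirPolynomial (stdBasis (N + 3)) (casimir N a) :=
  ⟨⟨casimirPoly N a, fun _ => rfl⟩, isCasimir_casimir N a⟩

theorem linearIndependent_fderiv_casimir {N : ℕ} {x : Fin (N + 3) → ℝ}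
    (hx : x (Fin.last (N + 2)) ≠ 0) :
    LinearIndependent ℝ fun a => fderiv ℝ (casimir N a) x := by
  have hlast : coord x (N + 2) ≠ 0 := by simpa [coord, Fin.last] using hx
  -- Test directions, skipping x₁ and s = x_{n-1}; the diagonal entries are x_n^(N + 3) and, for the
  -- last Casimir, 1.
  let idx : Fin (N + 1) → Fin (N + 3) := fun b =>
    if b.val < N then ⟨b.val + 1, by omega⟩ else Fin.last (N + 2)
  refine linearIndependent_of_triangular (fun b => Pi.single (idx b) 1) ?_ ?_
  · intro a b hab
    have hb : b.val < N := by omega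
    have hab : b.val < a.val := hab
    rw [show casimir N a = fun y => MvPolynomial.eval y (casimirPoly N a) from rfl,
      fderiv_eval_single, casimirPoly]
    simp only [idx, if_pos hb]
    split_ifs
    · rw [pderiv_invariantPoly _ (by simp; omega) (by simp; omega), if_neg (by simp; omega),
        map_zero]
    · rw [pderiv_coordPoly, if_neg (by simp; omega), map_zero]
  · intro a
    rw [show casimir N a = fun y => MvPolynomial.eval y (casimirPoly N a) from rfl,
      fderiv_eval_single, casimirPoly]
    simp only [idx]
    split_ifs
    · rw [pderiv_invariantPoly _ (by simp; omega) (by simp), if_pos rfl, map_pow, eval_coordPoly]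
      exact pow_ne_zero _ hlast
    · rw [pderiv_coordPoly, if_pos (by simp), map_one]
      exact one_ne_zero

theorem linearIndependent_fderiv_cons {N : ℕ} {F : (Fin (N + 3) → ℝ) → ℝ} {x : Fin (N + 3) → ℝ}
    (hx : x (Fin.last (N + 2)) ≠ 0)
    (hF : fderiv ℝ F x (firstVec (N + 3)) ≠ 0 ∨ fderiv ℝ F x (shift x) ≠ 0) :
    LinearIndependent ℝ fun a =>
      fderiv ℝ ((Fin.cons F (casimir N) : Fin (N + 2) → (Fin (N + 3) → ℝ) → ℝ) a) x := by
  have hcons : (fun a => fderiv ℝ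
      ((Fin.cons F (casimir N) : Fin (N + 2) → (Fin (N + 3) → ℝ) → ℝ) a) x) =
      Fin.cons (fderiv ℝ F x) fun a => fderiv ℝ (casimir N a) x := by
    funext a
    refine Fin.cases ?_ (fun b => ?_) a <;> simp
  rw [hcons, linearIndependent_finCons]
  refine ⟨linearIndependent_fderiv_casimir hx, fun hmem => ?_⟩
  -- A vector killed by all Casimir differentials is killed by their span, whereas `hF` provides
  -- such a vector not killed by dF.
  have hker : ∀ v, (∀ a, fderiv ℝ (casimir N a) x v = 0) → fderiv ℝ F x v = 0 := by
    intro v hv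
    refine Submodule.span_induction (p := fun φ _ => φ v = 0) ?_ rfl ?_ ?_ hmem
    · rintro _ ⟨a, rfl⟩
      exact hv a
    · intro φ ψ _ _ h1 h2
      simp [h1, h2]
    · intro c φ _ h
      simp [h]
  rcases hF with h | h
  · exact h (hker _ fun a => fderiv_casimir_firstVec N a x)
  · exact h (hker _ fun a => fderiv_casimir_shift N a x)

theorem isCompleteInvolutive_cons {N : ℕ} {H F : (Fin (N + 3) → ℝ) → ℝ} (hF : ContDiff ℝ ∞ F)
    (hFH : ∀ x, liePoisson (stdBasis (N + 3)) F H x = 0) :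
    IsCompleteInvolutive (stdBasis (N + 3)) H
      (Fin.cons F (casimir N) : Fin (N + 2) → (Fin (N + 3) → ℝ) → ℝ) where
  smooth a := by
    refine Fin.cases ?_ (fun b => ?_) a
    · simpa using hF
    · simpa using contDiff_casimir N b
  firstIntegral a x := by
    rw [fderiv_eulerField]
    refine Fin.cases ?_ (fun b => ?_) a
    · simpa using hFH x
    · simp [liePoisson_eq, fderiv_casimir_firstVec, fderiv_casimir_shift]
  involution a c x := by
    rw [liePoisson_eq]
    refine Fin.cases ?_ (fun b => ?_) a
    · refine Fin.cases ?_ (fun d => ?_) c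
      · simp only [Fin.cons_zero]
        ring
      · simp [fderiv_casimir_firstVec, fderiv_casimir_shift]
    · simp [fderiv_casimir_firstVec, fderiv_casimir_shift]
  number := by
    rw [genericRank_eq_two, Fintype.card_fin]
    ring

/-! ### Regular points of a first integral -/

theorem contDiff_shift (n : ℕ) : ContDiff ℝ ω (shift : (Fin n → ℝ) → Fin n → ℝ) := by
  refine contDiff_pi.2 fun i => ?_
  simp only [shift, coord]
  split_ifs
  · exact contDiff_apply ℝ ℝ _
  · exact contDiff_const
  · exact contDiff_const

/-- The set of points where `F` is not critical on its symplectic leaf. -/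
def regularSet {n : ℕ} (F : (Fin n → ℝ) → ℝ) : Set (Fin n → ℝ) :=
  {x | fderiv ℝ F x (firstVec n) ≠ 0 ∨ fderiv ℝ F x (shift x) ≠ 0}

theorem isOpen_regularSet {n : ℕ} {F : (Fin n → ℝ) → ℝ} (hF : ContDiff ℝ ∞ F) :
    IsOpen (regularSet F) := by
  have hd : Continuous (fderiv ℝ F) := hF.continuous_fderiv (by simp)
  exact (isOpen_ne_fun (hd.clm_apply continuous_const) continuous_const).union
    (isOpen_ne_fun (hd.clm_apply (contDiff_shift n).continuous) continuous_const)

theorem exists_regularSet_of_not_isCasimir {n : ℕ} {F : (Fin n → ℝ) → ℝ} (hF : ContDiff ℝ ∞ F)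
    (h : ¬ IsCasimir (stdBasis n) F) : ∃ x, x ∈ regularSet F := by
  by_contra! hx
  refine h (isCasimir_of_fderiv_eq_zero hF fun x => ?_)
  have := hx x
  simpa only [regularSet, Set.mem_ofPred_eq, not_or, not_not] using this

theorem ae_mem_regularSet {n : ℕ} {F : (Fin n → ℝ) → ℝ} (hF : AnalyticOnNhd ℝ F Set.univ)
    {x₀ : Fin n → ℝ} (hx₀ : x₀ ∈ regularSet F) : ∀ᵐ x : Fin n → ℝ, x ∈ regularSet F := by
  have hd : ContDiff ℝ ω (fderiv ℝ F) := contDiff_omega_iff_analyticOnNhd.2 hF.fderiv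
  rcases hx₀ with h | h
  · filter_upwards [ae_ne_zero_of_analyticOnNhd_pi (contDiff_omega_iff_analyticOnNhd.1
      (hd.clm_apply (contDiff_const (c := firstVec n)))) h] with x hx
    exact Or.inl hx
  · filter_upwards [ae_ne_zero_of_analyticOnNhd_pi (contDiff_omega_iff_analyticOnNhd.1
      (hd.clm_apply (contDiff_shift n))) h] with x hx
    exact Or.inr hx

theorem ae_last_ne_zero (N : ℕ) : ∀ᵐ x : Fin (N + 3) → ℝ, x (Fin.last (N + 2)) ≠ 0 :=
  Measure.ae_eval_ne (μ := fun _ : Fin (N + 3) => (volume : Measure ℝ)) (Fin.last (N + 2)) 0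

theorem dense_last_ne_zero (N : ℕ) : Dense {x : Fin (N + 3) → ℝ | x (Fin.last (N + 2)) ≠ 0} :=
  Measure.dense_of_ae (ae_last_ne_zero N)

theorem isOpen_last_ne_zero (N : ℕ) : IsOpen {x : Fin (N + 3) → ℝ | x (Fin.last (N + 2)) ≠ 0} :=
  isOpen_ne_fun (continuous_apply _) continuous_const

/-- For a suitable `c`, the derivative of `g * exp (c x₁)` along `x₁` vanishes on no nonempty open
subset of the support of `g`: for distinct `c` such subsets would be disjoint. -/
theorem exists_interior_critical_eq_empty {n : ℕ} (g : (Fin n → ℝ) → ℝ) :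
    ∃ c : ℝ, interior {x | g x ≠ 0 ∧ fderiv ℝ g x (firstVec n) + c * g x = 0} = ∅ := by
  set O : ℝ → Set (Fin n → ℝ) :=
    fun c => interior {x | g x ≠ 0 ∧ fderiv ℝ g x (firstVec n) + c * g x = 0} with hO
  have hdisj : ({c | (O c).Nonempty} : Set ℝ).PairwiseDisjoint O := by
    intro c _ d _ hcd
    refine Set.disjoint_left.2 fun x hc hd => hcd ?_
    obtain ⟨hg, h1⟩ := interior_subset hc
    obtain ⟨-, h2⟩ := interior_subset hd
    have : (c - d) * g x = 0 := by linarith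
    exact sub_eq_zero.1 ((mul_eq_zero.1 this).resolve_right hg)
  -- By separability, disjoint nonempty open sets are countably many, so some real c is left over.
  have hcount : ({c | (O c).Nonempty} : Set ℝ).Countable :=
    hdisj.countable_of_isOpen (fun _ _ => isOpen_interior) fun _ h => h
  obtain ⟨c, hc⟩ := (hcount.dense_compl ℝ).nonempty
  exact ⟨c, Set.not_nonempty_iff_eq_empty.1 hc⟩

theorem fderiv_mul_exp {n : ℕ} {g : (Fin (n + 1) → ℝ) → ℝ} (hg : Differentiable ℝ g) (c : ℝ)
    (x : Fin (n + 1) → ℝ) :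
    fderiv ℝ (fun y => g y * Real.exp (c * y 0)) x (firstVec (n + 1)) =
      Real.exp (c * x 0) * (fderiv ℝ g x (firstVec (n + 1)) + c * g x) := by
  rw [fderiv_fun_mul (hg x) (by fun_prop), fderiv_exp (by fun_prop),
    fderiv_const_mul (by fun_prop), fderiv_coordinate]
  simp [firstVec]
  ring

/-- Every smooth Hamiltonian has a smooth first integral that is regular on a dense set: on the
interior of the critical set of `H` one adds a function supported there. -/
theorem exists_firstIntegral_dense_regularSet {n : ℕ} {H : (Fin (n + 1) → ℝ) → ℝ}
    (hH : ContDiff ℝ ∞ H) :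
    ∃ F : (Fin (n + 1) → ℝ) → ℝ, ContDiff ℝ ∞ F ∧
      (∀ x, liePoisson (stdBasis (n + 1)) F H x = 0) ∧ Dense (regularSet F) := by
  obtain ⟨g, hgV, hg, hgr⟩ :=
    (isOpen_interior (s := (regularSet H)ᶜ)).exists_contDiff_support_eq (n := ⊤)
  have hg0 : ∀ y, 0 ≤ g y := fun y => (hgr (Set.mem_range_self y)).1
  obtain ⟨c, hc⟩ := exists_interior_critical_eq_empty g
  have hG : ContDiff ℝ ∞ fun y : Fin (n + 1) → ℝ => g y * Real.exp (c * y 0) :=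
    hg.mul (Real.contDiff_exp.comp (contDiff_const.mul (contDiff_apply ℝ ℝ 0)))
  set G : (Fin (n + 1) → ℝ) → ℝ := fun y => g y * Real.exp (c * y 0) with hGdef
  have hsum : ∀ x, fderiv ℝ (fun y => H y + G y) x = fderiv ℝ H x + fderiv ℝ G x := fun x =>
    fderiv_fun_add (hH.differentiable (by simp) x) (hG.differentiable (by simp) x)
  have hmem : ∀ x, g x ≠ 0 ↔ x ∈ interior (regularSet H)ᶜ := fun x => by
    rw [← hgV, Function.mem_support]
  -- G is nonnegative, so its zeros are minima.
  have hoff : ∀ x, g x = 0 → fderiv ℝ G x = 0 := fun x hx =>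
    IsLocalMin.fderiv_eq_zero (Filter.Eventually.of_forall fun y => show G x ≤ G y by
      simp only [hGdef, hx, zero_mul]
      exact mul_nonneg (hg0 y) (Real.exp_pos _).le)
  have hon : ∀ x, g x ≠ 0 → fderiv ℝ H x (firstVec (n + 1)) = 0 ∧ fderiv ℝ H x (shift x) = 0 :=
    fun x hx => by
      simpa [regularSet] using interior_subset ((hmem x).1 hx)
  refine ⟨fun y => H y + G y, hH.add hG, fun x => ?_, dense_iff_inter_open.2 ?_⟩
  -- Off the support of g, dF = dH and antisymmetry applies; on the support, dH kills both vectors.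
  · rw [liePoisson_eq, hsum]
    by_cases hx : g x = 0
    · rw [hoff x hx, add_zero]
      ring
    · rw [(hon x hx).1, (hon x hx).2]
      ring
  · intro O hO hne
    by_cases hsub : O ⊆ (regularSet H)ᶜ
    · have hOV : O ⊆ interior (regularSet H)ᶜ := interior_maximal hsub hO
      obtain ⟨x, hxO, hx⟩ : ∃ x ∈ O, fderiv ℝ g x (firstVec (n + 1)) + c * g x ≠ 0 := by
        by_contra! hall
        obtain ⟨x, hx⟩ := hne
        have : x ∈ interior {x | g x ≠ 0 ∧ fderiv ℝ g x (firstVec (n + 1)) + c * g x = 0} :=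
          interior_maximal (fun y hy => show _ ∧ _ from ⟨(hmem y).2 (hOV hy), hall y hy⟩)
            hO hx
        rwa [hc] at this
      refine ⟨x, hxO, Or.inl ?_⟩
      rw [hsum, _root_.add_apply, (hon x ((hmem x).2 (hOV hxO))).1, zero_add,
        fderiv_mul_exp (hg.differentiable (by simp))]
      exact mul_ne_zero (Real.exp_ne_zero _) hx
    -- At a regular point of H, g vanishes, so F has the same differential as H.
    · obtain ⟨x, hxO, hx⟩ := Set.not_subset.1 hsub
      have hgx : g x = 0 := by
        by_contra h
        exact hx (interior_subset ((hmem x).1 h))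
      refine ⟨x, hxO, ?_⟩
      rw [regularSet, Set.mem_ofPred_eq, hsum, hoff x hgx, add_zero]
      exact not_not.1 hx

/-! ### Integrability -/

theorem exists_completeInvolutive_of_le_two {n : ℕ} (hn : n ≤ 2) (H : (Fin n → ℝ) → ℝ) :
    ∃ F : Fin n → (Fin n → ℝ) → ℝ, IsCompleteInvolutive (stdBasis n) H F ∧
      ∀ x, LinearIndependent ℝ fun a => fderiv ℝ (F a) x := by
  have hzero : ∀ f g x, liePoisson (stdBasis n) f g x = 0 := fun f g x => by
    rw [liePoisson_eq, shift_eq_zero hn, map_zero, map_zero, mul_zero, zero_mul, sub_zero]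
  refine ⟨fun a y => y a, ⟨fun a => contDiff_apply ℝ ℝ a, fun a x => ?_,
    fun a c x => hzero _ _ x, ?_⟩, fun x => ?_⟩
  · rw [fderiv_eulerField, hzero]
  · rw [genericRank_eq_zero hn, Fintype.card_fin, add_zero]
  · refine linearIndependent_of_triangular (fun b => Pi.single b 1) (fun a b hab => ?_)
      fun a => ?_
    · rw [fderiv_coordinate]
      simp [hab.ne']
    · rw [fderiv_coordinate]
      simp

theorem functionallyIndependentAE_cons {N : ℕ} {F : (Fin (N + 3) → ℝ) → ℝ}
    (hF : AnalyticOnNhd ℝ F Set.univ) {x₀ : Fin (N + 3) → ℝ} (hx₀ : x₀ ∈ regularSet F) :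
    FunctionallyIndependentAE
      (Fin.cons F (casimir N) : Fin (N + 2) → (Fin (N + 3) → ℝ) → ℝ) := by
  filter_upwards [ae_last_ne_zero N, ae_mem_regularSet hF hx₀] with x hx h
  exact linearIndependent_fderiv_cons hx h

theorem exists_dense_integrals {N : ℕ} {H : (Fin (N + 3) → ℝ) → ℝ} (hH : ContDiff ℝ ∞ H) :
    ∃ F : Fin (N + 2) → (Fin (N + 3) → ℝ) → ℝ,
      IsCompleteInvolutive (stdBasis (N + 3)) H F ∧ FunctionallyIndependentOnDense F := by
  obtain ⟨F, hF, hFH, hdense⟩ := exists_firstIntegral_dense_regularSet hH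
  exact ⟨_, isCompleteInvolutive_cons hF hFH, _,
    (isOpen_last_ne_zero N).inter (isOpen_regularSet hF),
    (dense_last_ne_zero N).inter_of_isOpen_left hdense (isOpen_last_ne_zero N),
    fun x hx => linearIndependent_fderiv_cons hx.1 hx.2⟩

theorem completeInvolutive_hamiltonian_casimir {N : ℕ} {H : (Fin (N + 3) → ℝ) → ℝ}
    (hH : AnalyticOnNhd ℝ H Set.univ) (hc : ¬ IsCasimir (stdBasis (N + 3)) H) :
    IsCompleteInvolutive (stdBasis (N + 3)) H
        (Fin.cons H (casimir N) : Fin (N + 2) → (Fin (N + 3) → ℝ) → ℝ) ∧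
      FunctionallyIndependentAE
        (Fin.cons H (casimir N) : Fin (N + 2) → (Fin (N + 3) → ℝ) → ℝ) := by
  have hs : ContDiff ℝ ∞ H := (contDiff_omega_iff_analyticOnNhd.2 hH).of_le le_top
  obtain ⟨x₀, hx₀⟩ := exists_regularSet_of_not_isCasimir hs hc
  refine ⟨isCompleteInvolutive_cons hs fun x => ?_, functionallyIndependentAE_cons hH hx₀⟩
  rw [liePoisson_eq]
  ring

theorem exists_ae_integrals {N : ℕ} {H : (Fin (N + 3) → ℝ) → ℝ}
    (hH : AnalyticOnNhd ℝ H Set.univ) :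
    ∃ F : Fin (N + 2) → (Fin (N + 3) → ℝ) → ℝ,
      IsCompleteInvolutive (stdBasis (N + 3)) H F ∧ FunctionallyIndependentAE F := by
  by_cases hc : IsCasimir (stdBasis (N + 3)) H
  -- For Casimir H every function is a first integral; x₁ is regular everywhere because dx₁ is 1 on
  -- `firstVec`.
  · have hω : ContDiff ℝ ω fun y : Fin (N + 3) → ℝ => y 0 := contDiff_apply ℝ ℝ 0
    refine ⟨_, isCompleteInvolutive_cons (hω.of_le le_top)
      fun x => liePoisson_eq_zero_of_isCasimir hc _ x,
      functionallyIndependentAE_cons (contDiff_omega_iff_analyticOnNhd.1 hω) (x₀ := 0) ?_⟩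
    left
    rw [fderiv_coordinate]
    simp [firstVec]
  · exact ⟨_, completeInvolutive_hamiltonian_casimir hH hc⟩

end Filiform

theorem proposition3 (n : ℕ) :
    (3 ≤ n → ∀ᵐ x : Fin n → ℝ, (poissonMatrix (Filiform.stdBasis n) x).rank = 2) ∧
    ∀ H : (Fin n → ℝ) → ℝ, ¬ IsCasimirPolynomial (Filiform.stdBasis n) H →
      (ContDiff ℝ ∞ H →
        ∃ (m : ℕ) (F : Fin m → (Fin n → ℝ) → ℝ),
          IsCompleteInvolutive (Filiform.stdBasis n) H F ∧ FunctionallyIndependentOnDense F) ∧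
      (AnalyticOnNhd ℝ H Set.univ →
        ∃ (m : ℕ) (F : Fin m → (Fin n → ℝ) → ℝ),
          IsCompleteInvolutive (Filiform.stdBasis n) H F ∧ FunctionallyIndependentAE F) ∧
      (AnalyticOnNhd ℝ H Set.univ → ¬ IsCasimir (Filiform.stdBasis n) H →
        ∃ C : Fin (n - 2) → (Fin n → ℝ) → ℝ,
          (∀ a, IsCasimirPolynomial (Filiform.stdBasis n) (C a)) ∧
          IsCompleteInvolutive (Filiform.stdBasis n) H
            (Fin.cons H C : Fin (n - 2 + 1) → (Fin n → ℝ) → ℝ) ∧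
          FunctionallyIndependentAE
            (Fin.cons H C : Fin (n - 2 + 1) → (Fin n → ℝ) → ℝ)) := by
  constructor
  · intro hn
    obtain ⟨N, rfl⟩ : ∃ N, n = N + 3 := ⟨n - 3, by omega⟩
    filter_upwards [Filiform.ae_last_ne_zero N] with x hx
    exact Filiform.rank_poissonMatrix hx
  · intro H _
    rcases Nat.lt_or_ge 2 n with hn | hn
    · obtain ⟨N, rfl⟩ : ∃ N, n = N + 3 := ⟨n - 3, by omega⟩
      exact ⟨fun hH => ⟨_, Filiform.exists_dense_integrals hH⟩,
        fun hH => ⟨_, Filiform.exists_ae_integrals hH⟩,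
        fun hH hc => ⟨Filiform.casimir N, Filiform.isCasimirPolynomial_casimir N,
          Filiform.completeInvolutive_hamiltonian_casimir hH hc⟩⟩
    · obtain ⟨F, hF, hind⟩ := Filiform.exists_completeInvolutive_of_le_two hn H
      refine ⟨fun _ => ⟨n, F, hF, Set.univ, isOpen_univ, dense_univ, fun x _ => hind x⟩,
        fun _ => ⟨n, F, hF, Filter.Eventually.of_forall hind⟩, fun hH hc => absurd ?_ hc⟩
      -- With zero bracket every smooth function is Casimir, so the third clause is vacuous.
      refine ⟨(contDiff_omega_iff_analyticOnNhd.2 hH).of_le le_top, fun i x => ?_⟩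
      rw [Filiform.liePoisson_eq, Filiform.shift_eq_zero hn, map_zero, map_zero, mul_zero,
        zero_mul, sub_zero]
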